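/- Let $n\ge 0$ and equip $\mathbb C^{n+1}$ with the Hermitian form $\langle z,w\rangle=-z_0\overline{w}_0+z_1\overline{w}_1+\cdots+z_n\overline{w}_n$ of signature $(n,1)$. Let $\mathbf H^n_{\mathbb C}$ be complex hyperbolic space, i.e. the set of complex lines $[v]$ in $\mathbb C^{n+1}$ with $\langle v,v\rangle<0$, with the distance given by $\cosh^2\frac{d([z],[w])}{2}=\frac{\langle z,w\rangle\langle w,z\rangle}{\langle z,z\rangle\langle w,w\rangle}$, and identified with the open unit ball of $\mathbb C^n$ by $[(z_0,\dots,z_n)]\mapsto(z_1/z_0,\dots,z_n/z_0)$. Let $\mathrm I(\mathbf H^n_{\mathbb C})$ be the full isometry group of $\mathbf H^n_{\mathbb C}$, i.e. the group of all bijections of $\mathbf H^n_{\mathbb C}$ that preserve $d$. Then every holomorphic isometry of $\mathbf H^n_{\mathbb C}$, i.e. every $f\in\mathrm I(\mathbf H^n_{\mathbb C})$ that is holomorphic as a self-map of the unit ball, is a commutator in $\mathrm I(\mathbf H^n_{\mathbb C})$: there are $\alpha,\beta\in\mathrm I(\mathbf H^n_{\mathbb C})$ with $f=[\alpha,\beta]=\alpha\beta\alpha^{-1}\beta^{-1}$.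 -/

import Mathlib

open scoped LinearAlgebra.Projectivization

namespace ComplexHyperbolic

/-- The standard Hermitian form of signature `(n,1)` on `ℂ^{n+1}`,
`⟨z,w⟩ = -z₀ w̄₀ + z₁ w̄₁ + ⋯ + zₙ w̄ₙ`. -/
def form {n : ℕ} (z w : Fin (n + 1) → ℂ) : ℂ :=
  -(z 0 * star (w 0)) + ∑ i : Fin n, z i.succ * star (w i.succ)

/-- The real number `⟨z,z⟩`. -/
def quad {n : ℕ} (z : Fin (n + 1) → ℂ) : ℝ := (form z z).re

/-- Complex hyperbolic space: the set of complex lines in `ℂ^{n,1}` spanned by a vector `v` with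
`⟨v,v⟩ < 0`, as a subset of the projective space of `ℂ^{n+1}`. -/
def Space (n : ℕ) : Type := {p : ℙ ℂ (Fin (n + 1) → ℂ) // quad p.rep < 0}

/-- The hyperbolic (Bergman) distance on complex hyperbolic space:
`cosh² (d(p,q)/2) = (⟨z,w⟩ ⟨w,z⟩) / (⟨z,z⟩ ⟨w,w⟩)`, for any `z ∈ p` and `w ∈ q` nonzero. -/
noncomputable def hdist {n : ℕ} (p q : Space n) : ℝ :=
  2 * Real.arcosh
    (‖form p.1.rep q.1.rep‖ / Real.sqrt (quad p.1.rep * quad q.1.rep))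

/-- The ball coordinates of a point of complex hyperbolic space: the line spanned by
`(z₀, z₁, …, zₙ)` goes to `(z₁/z₀, …, zₙ/z₀)`, a point of the open unit ball of `ℂⁿ`. -/
noncomputable def ballCoord {n : ℕ} (p : Space n) : EuclideanSpace ℂ (Fin n) :=
  WithLp.toLp 2 fun i => p.1.rep i.succ / p.1.rep 0

/-- The full isometry group of complex hyperbolic space: all bijections preserving the distance. -/
def Isom (n : ℕ) : Subgroup (Equiv.Perm (Space n)) where
  carrier := {f | ∀ p q, hdist (f p) (f q) = hdist p q}
  mul_mem' := fun {f g} hf hg p q => (hf (g p) (g q)).trans (hg p q)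
  one_mem' := fun _ _ => rfl
  inv_mem' := fun {f} hf p q => by
    have h := hf (f⁻¹ p) (f⁻¹ q)
    simp only [Equiv.Perm.inv_def, Equiv.apply_symm_apply] at h
    exact h.symm

/-- A self-map of complex hyperbolic space is holomorphic if, in ball coordinates, it is a
holomorphic map on the open unit ball of `ℂⁿ`. -/
def IsHolomorphic {n : ℕ} (f : Space n → Space n) : Prop :=
  ∃ F : EuclideanSpace ℂ (Fin n) → EuclideanSpace ℂ (Fin n),
    DifferentiableOn ℂ F (Metric.ball 0 1) ∧ ∀ p, ballCoord (f p) = F (ballCoord p)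

/-! The definitions above do not depend on the chosen representatives, and the ball coordinates
identify complex hyperbolic space with the open unit ball. -/

theorem form_smul_smul {n : ℕ} (a b : ℂ) (z w : Fin (n + 1) → ℂ) :
    form (a • z) (b • w) = a * star b * form z w := by
  simp only [form, Pi.smul_apply, smul_eq_mul, star_mul', mul_add, Finset.mul_sum]
  congr 1
  · ring
  · exact Finset.sum_congr rfl fun i _ => by ring

theorem quad_smul {n : ℕ} (a : ℂ) (z : Fin (n + 1) → ℂ) :
    quad (a • z) = ‖a‖ ^ 2 * quad z := by
  have h : a * star a = ((‖a‖ ^ 2 : ℝ) : ℂ) := by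
    simpa using Complex.mul_conj' a
  rw [quad, form_smul_smul, h, Complex.re_ofReal_mul, quad]

theorem quad_eq {n : ℕ} (z : Fin (n + 1) → ℂ) :
    quad z = -‖z 0‖ ^ 2 + ∑ i : Fin n, ‖z i.succ‖ ^ 2 := by
  have h : ∀ a : ℂ, a * star a = ((‖a‖ ^ 2 : ℝ) : ℂ) := fun a => by
    simpa using Complex.mul_conj' a
  simp only [quad, form, h]
  rw [← Complex.ofReal_sum, ← Complex.ofReal_neg, ← Complex.ofReal_add, Complex.ofReal_re]

theorem quad_rep_mk_neg_iff {n : ℕ} (v : Fin (n + 1) → ℂ) (hv : v ≠ 0) :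
    quad (Projectivization.mk ℂ v hv).rep < 0 ↔ quad v < 0 := by
  obtain ⟨a, ha⟩ := Projectivization.exists_smul_eq_mk_rep ℂ v hv
  have hpos : 0 < ‖(a : ℂ)‖ ^ 2 := by have := a.ne_zero; positivity
  rw [← ha, Units.smul_def, quad_smul, ← neg_pos, ← mul_neg, mul_pos_iff_of_pos_left hpos, neg_pos]

theorem hdist_mk {n : ℕ} (v w : Fin (n + 1) → ℂ) (hv : v ≠ 0) (hw : w ≠ 0)
    (hv' : quad (Projectivization.mk ℂ v hv).rep < 0)
    (hw' : quad (Projectivization.mk ℂ w hw).rep < 0) :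
    hdist (n := n) ⟨Projectivization.mk ℂ v hv, hv'⟩ ⟨Projectivization.mk ℂ w hw, hw'⟩ =
      2 * Real.arcosh (‖form v w‖ / Real.sqrt (quad v * quad w)) := by
  obtain ⟨a, ha⟩ := Projectivization.exists_smul_eq_mk_rep ℂ v hv
  obtain ⟨b, hb⟩ := Projectivization.exists_smul_eq_mk_rep ℂ w hw
  have ha0 : ‖(a : ℂ)‖ ≠ 0 := norm_ne_zero_iff.2 a.ne_zero
  have hb0 : ‖(b : ℂ)‖ ≠ 0 := norm_ne_zero_iff.2 b.ne_zero
  have e : ‖(a : ℂ)‖ ^ 2 * quad v * (‖(b : ℂ)‖ ^ 2 * quad w) =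
      (‖(a : ℂ)‖ * ‖(b : ℂ)‖) ^ 2 * (quad v * quad w) := by ring
  simp only [hdist, ← ha, ← hb, Units.smul_def, quad_smul, form_smul_smul, norm_mul, norm_star]
  rw [e, Real.sqrt_mul (by positivity), Real.sqrt_sq (by positivity),
    mul_div_mul_left _ _ (mul_ne_zero ha0 hb0)]

theorem ballCoord_mk {n : ℕ} (v : Fin (n + 1) → ℂ) (hv : v ≠ 0)
    (hv' : quad (Projectivization.mk ℂ v hv).rep < 0) :
    ballCoord (n := n) ⟨Projectivization.mk ℂ v hv, hv'⟩ =
      WithLp.toLp 2 fun i => v i.succ / v 0 := by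
  obtain ⟨a, ha⟩ := Projectivization.exists_smul_eq_mk_rep ℂ v hv
  simp only [ballCoord, ← ha, Units.smul_def, Pi.smul_apply, smul_eq_mul]
  congr 1
  funext i
  exact mul_div_mul_left _ _ a.ne_zero

theorem rep_zero_ne_zero {n : ℕ} (p : Space n) : p.1.rep 0 ≠ 0 := by
  intro h
  have h1 := p.2
  rw [quad_eq, h] at h1
  have h2 : 0 ≤ ∑ i : Fin n, ‖p.1.rep i.succ‖ ^ 2 := Finset.sum_nonneg fun _ _ => by positivity
  simp only [norm_zero] at h1
  linarith

theorem ballCoord_injective {n : ℕ} : Function.Injective (ballCoord (n := n)) := by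
  intro p q h
  have hp := rep_zero_ne_zero p
  have hq := rep_zero_ne_zero q
  apply Subtype.ext
  rw [← p.1.mk_rep, ← q.1.mk_rep, Projectivization.mk_eq_mk_iff']
  refine ⟨p.1.rep 0 / q.1.rep 0, ?_⟩
  funext j
  refine Fin.cases ?_ (fun i => ?_) j
  · simp [hq]
  · have hi : p.1.rep i.succ / p.1.rep 0 = q.1.rep i.succ / q.1.rep 0 :=
      congrArg (fun x : EuclideanSpace ℂ (Fin n) => x i) h
    rw [Pi.smul_apply, smul_eq_mul, div_mul_eq_mul_div, mul_div_assoc, ← hi, mul_div_cancel₀ _ hp]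

theorem range_ballCoord {n : ℕ} : Set.range (ballCoord (n := n)) = Metric.ball 0 1 := by
  ext x
  rw [mem_ball_zero_iff, ← sq_lt_one_iff₀ (norm_nonneg x), EuclideanSpace.norm_sq_eq]
  constructor
  · rintro ⟨p, rfl⟩
    have h1 := p.2
    have hp : 0 < ‖p.1.rep 0‖ ^ 2 := by have := rep_zero_ne_zero p; positivity
    rw [quad_eq] at h1
    simp only [ballCoord, norm_div, div_pow]
    rw [← Finset.sum_div, div_lt_one hp]
    linarith
  · intro hx
    have h0 : (Fin.cons 1 x.ofLp : Fin (n + 1) → ℂ) ≠ 0 := fun h => by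
      simpa using congrFun h 0
    refine ⟨⟨Projectivization.mk ℂ (Fin.cons 1 x.ofLp) h0, ?_⟩, ?_⟩
    · rw [quad_rep_mk_neg_iff, quad_eq]
      simp only [Fin.cons_zero, Fin.cons_succ, norm_one]
      linarith
    · rw [ballCoord_mk]
      simp

end ComplexHyperbolic

open Polynomial

/-! A holomorphic isometry lifts to a unitary map `A` of signature `(n,1)`
(`exists_unitary_of_isHolomorphic`). It then suffices to find a unitary `C` with `C² = A` and an
antiunitary `σ` with `σ C = C⁻¹ σ`, since `C σ C⁻¹ σ⁻¹ = C C σ σ⁻¹ = A`.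

For `σ` (`exists_antiunitary_conj_inv`): space is spanned by mutually orthogonal `A`-orbits. On one
orbit `⟨A⁻ᵏe, A⁻ᵐe⟩ = ⟨Aᵐe, Aᵏe⟩`, so the families `(Aᵐe)` and `(A⁻ᵐe)` have conjugate Gram
matrices. By nondegeneracy an antiunitary map exchanges them, and it conjugates `A` to `A⁻¹`.

For `C` (`exists_unitary_sqrt`): take `C = p(A)` with `p² ≡ X` modulo the minimal polynomial of `A`.
The values of `p` at the eigenvalues are principal square roots, which forces `C` to be unitary;
being a polynomial in `A`, it is then inverted by `σ` as well.

The lift `A` comes from rigidity: once lifts are normalised against the image of the origin,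
distances fix the moduli of all their Hermitian products, and differentiating these at `0` shows
that the lift is affine in ball coordinates. -/

/-! ### Square roots of `X` modulo a polynomial -/

/-- A polynomial with nonzero constant term admits a square root of `X` modulo itself, whose values
at the roots are prescribed square roots. -/
theorem Polynomial.exists_sqrt_X_mod (m : ℂ[X]) (hm : m.eval 0 ≠ 0) (s : ℂ → ℂ)
    (hs : ∀ μ, s μ ^ 2 = μ) :
    ∃ p : ℂ[X], m ∣ p ^ 2 - X ∧ ∀ μ, m.IsRoot μ → p.eval μ = s μ := by
  classical
  have hm0 : m ≠ 0 := by rintro rfl; simp at hm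
  let p₀ : ℂ[X] := Lagrange.interpolate m.roots.toFinset id s
  have hp₀ : ∀ μ, m.IsRoot μ → p₀.eval μ = s μ := fun μ hμ =>
    Lagrange.eval_interpolate_at_node (v := id) s (Function.injective_id.injOn)
      (by simpa [hm0] using hμ)
  -- Each root of `m` kills `p₀² - X`; one factor per root, counted with multiplicity, makes `p₀² -
  -- X` nilpotent modulo `m`.
  have hdvd : m ∣ (p₀ ^ 2 - X) ^ Multiset.card m.roots := by
    have h1 := (IsAlgClosed.splits m).eq_prod_roots
    have h2 : (m.roots.map (X - C ·)).prod ∣ (m.roots.map fun _ => p₀ ^ 2 - X).prod := by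
      refine Multiset.prod_dvd_prod_of_dvd _ _ fun μ hμ => ?_
      rw [dvd_iff_isRoot]
      simp [hp₀ μ (isRoot_of_mem_roots hμ), hs]
    rw [Multiset.map_const', Multiset.prod_replicate] at h2
    rw [h1]
    exact (isUnit_C.2 (by simpa using hm0 : IsUnit m.leadingCoeff)).mul_left_dvd.2
      (by rwa [← h1])
  have hroot : IsUnit (AdjoinRoot.root m) := by
    have hc : IsCoprime (X : ℂ[X]) m :=
      irreducible_X.coprime_iff_not_dvd.2 (by rwa [X_dvd_iff, coeff_zero_eq_eval_zero])
    obtain ⟨u, v, huv⟩ := hc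
    have := congrArg (AdjoinRoot.mk m) huv
    simp only [map_add, map_mul, AdjoinRoot.mk_X, AdjoinRoot.mk_self, mul_zero, add_zero,
      map_one] at this
    exact IsUnit.of_mul_eq_one_right _ this
  have hnil : IsNilpotent (AdjoinRoot.mk m p₀ ^ 2 - AdjoinRoot.root m) :=
    ⟨Multiset.card m.roots, by
      rw [← AdjoinRoot.mk_X, ← map_pow, ← map_sub, ← map_pow]
      exact AdjoinRoot.mk_eq_zero.2 hdvd⟩
  have hunit : IsUnit (AdjoinRoot.mk m p₀) := by
    have h := hnil.isUnit_add_left_of_commute hroot (mul_comm _ _)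
    rw [add_sub_cancel] at h
    exact (isUnit_pow_iff two_ne_zero).1 h
  -- Newton–Hensel lifting: `p₀` is a root of `Y² - X` up to a nilpotent and the derivative `2p₀` is
  -- a unit. The correction is nilpotent, so the values at the roots of `m` do not change.
  obtain ⟨r, ⟨⟨k, hk⟩, hr⟩, -⟩ := existsUnique_nilpotent_sub_and_aeval_eq_zero
    (P := (X ^ 2 - C (AdjoinRoot.root m) : (AdjoinRoot m)[X])) (x := AdjoinRoot.mk m p₀)
    (by simpa using hnil)
    (by
      have h2 : IsUnit (2 : AdjoinRoot m) := by
        have := (isUnit_iff_ne_zero.2 (two_ne_zero : (2 : ℂ) ≠ 0)).map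
          (algebraMap ℂ (AdjoinRoot m))
        rwa [map_ofNat] at this
      simpa [one_add_one_eq_two] using h2.mul hunit)
  obtain ⟨p, rfl⟩ := AdjoinRoot.mk_surjective r
  refine ⟨p, ?_, fun μ hμ => ?_⟩
  · rw [← AdjoinRoot.mk_eq_zero]
    simpa using hr
  · rw [← map_sub, ← map_pow, AdjoinRoot.mk_eq_zero] at hk
    have h := hμ.dvd hk
    rw [IsRoot.def, eval_pow] at h
    replace h := eq_zero_of_pow_eq_zero h
    rw [eval_sub, sub_eq_zero] at h
    rw [← h, hp₀ μ hμ]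

namespace ComplexHyperbolic

variable {n : ℕ}

/-! ### Algebra of the Hermitian form -/

theorem form_add_left (x y z : Fin (n + 1) → ℂ) : form (x + y) z = form x z + form y z := by
  simp only [form, Pi.add_apply, add_mul, Finset.sum_add_distrib]; ring

theorem form_smul_left (a : ℂ) (x z : Fin (n + 1) → ℂ) : form (a • x) z = a * form x z := by
  simpa using form_smul_smul a 1 x z

theorem star_form (x y : Fin (n + 1) → ℂ) : star (form x y) = form y x := by
  simp only [form, star_add, star_neg, star_mul', star_sum, star_star]
  simp only [mul_comm]

theorem form_add_right (x y z : Fin (n + 1) → ℂ) : form z (x + y) = form z x + form z y := by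
  rw [← star_form, form_add_left, star_add, star_form, star_form]

theorem form_smul_right (a : ℂ) (x z : Fin (n + 1) → ℂ) :
    form z (a • x) = star a * form z x := by
  simpa using form_smul_smul 1 a z x

@[simp] theorem form_zero_left (z : Fin (n + 1) → ℂ) : form 0 z = 0 := by
  simpa using form_smul_left 0 0 z

@[simp] theorem form_zero_right (z : Fin (n + 1) → ℂ) : form z 0 = 0 := by
  rw [← star_form, form_zero_left, star_zero]

theorem form_sub_left (x y z : Fin (n + 1) → ℂ) : form (x - y) z = form x z - form y z := by
  rw [eq_sub_iff_add_eq, ← form_add_left, sub_add_cancel]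

theorem form_sub_right (x y z : Fin (n + 1) → ℂ) : form z (x - y) = form z x - form z y := by
  rw [eq_sub_iff_add_eq, ← form_add_right, sub_add_cancel]

theorem form_self (x : Fin (n + 1) → ℂ) : form x x = quad x :=
  (Complex.conj_eq_iff_re.1 (star_form x x)).symm

/-- The Hermitian form, linear in its first argument. -/
def formLeft (z : Fin (n + 1) → ℂ) : (Fin (n + 1) → ℂ) →ₗ[ℂ] ℂ where
  toFun x := form x z
  map_add' x y := form_add_left x y z
  map_smul' a x := form_smul_left a x z

@[simp] theorem formLeft_apply (x z : Fin (n + 1) → ℂ) : formLeft z x = form x z := rfl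

/-- Every linear functional is represented by the Hermitian form. -/
theorem exists_formLeft_eq (φ : (Fin (n + 1) → ℂ) →ₗ[ℂ] ℂ) : ∃ z, φ = formLeft z := by
  refine ⟨Fin.cons (-star (φ (Pi.single 0 1))) fun i => star (φ (Pi.single i.succ 1)), ?_⟩
  refine LinearMap.ext fun x => ?_
  conv_lhs => rw [pi_eq_sum_univ' x]
  simp [form, Fin.sum_univ_succ]

theorem eq_zero_of_form_eq_zero {x : Fin (n + 1) → ℂ} (h : ∀ y, form x y = 0) : x = 0 := by
  funext j
  refine Fin.cases ?_ (fun i => ?_) j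
  · simpa [form] using h (Pi.single 0 1)
  · simpa [form, Pi.single_apply] using h (Pi.single i.succ 1)

/-- The orthogonal complement of a negative vector is positive definite. -/
theorem eq_zero_of_form_eq_zero_of_quad {x u : Fin (n + 1) → ℂ} (hu : quad u < 0)
    (hxu : form x u = 0) (hx : quad x ≤ 0) : x = 0 := by
  rw [quad_eq] at hu hx
  have h1 : ‖x 0‖ * ‖u 0‖ ≤ ∑ i : Fin n, ‖x i.succ‖ * ‖u i.succ‖ := by
    have : x 0 * star (u 0) = ∑ i : Fin n, x i.succ * star (u i.succ) := by
      rw [form] at hxu; linear_combination -hxu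
    calc ‖x 0‖ * ‖u 0‖ = ‖x 0 * star (u 0)‖ := by rw [norm_mul, norm_star]
      _ ≤ _ := by
        rw [this]
        refine (norm_sum_le _ _).trans_eq (Finset.sum_congr rfl fun i _ => ?_)
        rw [norm_mul, norm_star]
  have h2 := Finset.sum_mul_sq_le_sq_mul_sq Finset.univ (fun i : Fin n => ‖x i.succ‖)
    (fun i => ‖u i.succ‖)
  have h3 : 0 ≤ ∑ i : Fin n, ‖x i.succ‖ ^ 2 := Finset.sum_nonneg fun _ _ => by positivity
  have h4 : 0 ≤ ∑ i : Fin n, ‖u i.succ‖ ^ 2 := Finset.sum_nonneg fun _ _ => by positivity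
  have h5 : (‖x 0‖ * ‖u 0‖) ^ 2 ≤ (∑ i : Fin n, ‖x i.succ‖ ^ 2) * ∑ i : Fin n, ‖u i.succ‖ ^ 2 :=
    (pow_le_pow_left₀ (by positivity) h1 2).trans h2
  have h6 : ‖x 0‖ ^ 2 = 0 := by
    -- With Cauchy–Schwarz this gives `|x₀|²|u₀|² ≤ |x₀|²|u'|²`, where `u'` denotes the remaining
    -- coordinates; since `|u'| < |u₀|`, this forces `x₀ = 0`.
    have h7 : (∑ i : Fin n, ‖x i.succ‖ ^ 2) * ∑ i : Fin n, ‖u i.succ‖ ^ 2 ≤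
        ‖x 0‖ ^ 2 * ∑ i : Fin n, ‖u i.succ‖ ^ 2 := by gcongr; linarith
    by_contra h
    have : 0 < ‖x 0‖ ^ 2 := lt_of_le_of_ne (by positivity) (Ne.symm h)
    nlinarith
  have h8 : ∑ i : Fin n, ‖x i.succ‖ ^ 2 = 0 := by linarith
  rw [Finset.sum_eq_zero_iff_of_nonneg fun _ _ => by positivity] at h8
  funext j
  refine Fin.cases ?_ (fun i => ?_) j
  · simpa using h6
  · simpa using h8 i (Finset.mem_univ i)

/-! ### Antiunitary maps conjugating a unitary map to its inverse -/

/-- The group of linear automorphisms preserving the Hermitian form. -/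
def unitary (n : ℕ) : Subgroup ((Fin (n + 1) → ℂ) ≃ₗ[ℂ] (Fin (n + 1) → ℂ)) where
  carrier := {A | ∀ x y, form (A x) (A y) = form x y}
  mul_mem' := fun {A B} hA hB x y => (hA (B x) (B y)).trans (hB x y)
  one_mem' := fun _ _ => rfl
  inv_mem' := fun {A} hA x y => by
    have h := hA (A⁻¹ x) (A⁻¹ y)
    rw [← LinearEquiv.mul_apply, ← LinearEquiv.mul_apply, mul_inv_cancel] at h
    exact h.symm

theorem form_inv_right {A : (Fin (n + 1) → ℂ) ≃ₗ[ℂ] (Fin (n + 1) → ℂ)} (hA : A ∈ unitary n)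
    (x y : Fin (n + 1) → ℂ) : form x (A⁻¹ y) = form (A x) y := by
  rw [← hA x (A⁻¹ y), ← LinearEquiv.mul_apply, mul_inv_cancel, LinearEquiv.coe_one, id]

/-- Choose an orthogonal system of orbits with maximal span. A nonzero vector orthogonal to a proper
span could be adjoined, unless it lies in that span and is therefore isotropic. Keeping a negative
vector in the system excludes this, as its orthogonal complement is positive definite. -/
theorem exists_orthogonal_cyclic_spanning (A : (Fin (n + 1) → ℂ) ≃ₗ[ℂ] (Fin (n + 1) → ℂ))
    (hA : A ∈ unitary n) :
    ∃ E : Set (Fin (n + 1) → ℂ),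
      (∀ e ∈ E, ∀ e' ∈ E, e ≠ e' → ∀ m : ℤ, form ((A ^ m) e) e' = 0) ∧
      Submodule.span ℂ (Set.range fun i : ℤ × E => (A ^ i.1) i.2) = ⊤ := by
  let span (E : Set (Fin (n + 1) → ℂ)) : Submodule ℂ (Fin (n + 1) → ℂ) :=
    Submodule.span ℂ (Set.range fun i : ℤ × E => (A ^ i.1) i.2)
  let e₀ : Fin (n + 1) → ℂ := Pi.single 0 1
  have he₀ : quad e₀ < 0 := by simp [quad_eq, e₀]
  let good : Set (Set (Fin (n + 1) → ℂ)) :=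
    {E | e₀ ∈ E ∧ ∀ e ∈ E, ∀ e' ∈ E, e ≠ e' → ∀ m : ℤ, form ((A ^ m) e) e' = 0}
  have hne : (span '' good).Nonempty := ⟨_, {e₀}, ⟨rfl, by
    rintro e rfl e' rfl h; exact absurd rfl h⟩, rfl⟩
  obtain ⟨_, ⟨E, ⟨hE₀, hE⟩, rfl⟩, hmax⟩ := wellFounded_gt.has_min _ hne
  have hsub : ∀ e ∈ E, ∀ m : ℤ, (A ^ m) e ∈ span E := fun e he m =>
    Submodule.subset_span ⟨(m, ⟨e, he⟩), rfl⟩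
  refine ⟨E, hE, by_contra fun htop => ?_⟩
  obtain ⟨φ, hφ, hker⟩ := Submodule.exists_le_ker_of_lt_top _ (lt_top_iff_ne_top.2 htop)
  obtain ⟨z, rfl⟩ := exists_formLeft_eq φ
  have hz : z ≠ 0 := by
    rintro rfl
    exact hφ (LinearMap.ext fun x => form_zero_right x)
  have horth : ∀ e ∈ E, ∀ m : ℤ, form ((A ^ m) e) z = 0 := fun e he m => hker (hsub e he m)
  have horth' : ∀ e ∈ E, ∀ m : ℤ, form ((A ^ m) z) e = 0 := fun e he m => by
    have := form_inv_right (zpow_mem hA m) z e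
    rw [← this, ← star_form, ← zpow_neg, horth e he, star_zero]
  refine hmax (span (insert z E)) ⟨insert z E, ⟨Set.mem_insert_of_mem _ hE₀, ?_⟩, rfl⟩ ?_
  · rintro e (rfl | he) e' (rfl | he') hne m
    · exact absurd rfl hne
    · exact horth' e' he' m
    · exact horth e he m
    · exact hE e he e' he' hne m
  · have hle : span E ≤ span (insert z E) := by
      refine Submodule.span_le.2 ?_
      rintro _ ⟨⟨m, e, he⟩, rfl⟩
      exact Submodule.subset_span ⟨(m, ⟨e, Set.mem_insert_of_mem _ he⟩), rfl⟩
    refine lt_of_le_of_ne hle fun heq => hz ?_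
    have hmem : z ∈ span E := by
      rw [heq]
      exact Submodule.subset_span ⟨(0, ⟨z, Set.mem_insert _ _⟩), by simp⟩
    have hzz : form z z = 0 := hker hmem
    refine eq_zero_of_form_eq_zero_of_quad he₀ (x := z) ?_ (by simp [quad, hzz])
    simpa using horth' e₀ hE₀ 0

/-- Two spanning families whose Gram matrices are conjugate are exchanged by an antiunitary map. -/
theorem exists_antiunitary_of_gram {ι : Type*} (x y : ι → Fin (n + 1) → ℂ)
    (hx : Submodule.span ℂ (Set.range x) = ⊤) (hy : Submodule.span ℂ (Set.range y) = ⊤)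
    (hxy : ∀ i j, form (y i) (y j) = form (x j) (x i)) :
    ∃ σ : (Fin (n + 1) → ℂ) → Fin (n + 1) → ℂ,
      (∀ v i, form (σ v) (y i) = form (x i) v) ∧
      (∀ u v, form (σ u) (σ v) = form v u) ∧ Function.Bijective σ := by
  have key : ∀ (x y : ι → Fin (n + 1) → ℂ) (hx : Submodule.span ℂ (Set.range x) = ⊤)
      (hxy : ∀ i j, form (y i) (y j) = form (x j) (x i)) (v : Fin (n + 1) → ℂ),
      ∃ w, ∀ i, form w (y i) = form (x i) v := by
    intro x y hx hxy v
    have hv : v ∈ Submodule.span ℂ (Set.range x) := hx ▸ Submodule.mem_top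
    induction hv using Submodule.span_induction with
    | mem v h => obtain ⟨j, rfl⟩ := h; exact ⟨y j, fun i => hxy j i⟩
    | zero => exact ⟨0, fun i => by simp⟩
    | add v v' _ _ h h' =>
      obtain ⟨w, hw⟩ := h
      obtain ⟨w', hw'⟩ := h'
      exact ⟨w + w', fun i => by rw [form_add_left, form_add_right, hw, hw']⟩
    | smul a v _ h =>
      obtain ⟨w, hw⟩ := h
      exact ⟨star a • w, fun i => by rw [form_smul_left, form_smul_right, hw]⟩
  have ext : ∀ (y : ι → Fin (n + 1) → ℂ) (hy : Submodule.span ℂ (Set.range y) = ⊤)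
      (w w' : Fin (n + 1) → ℂ), (∀ i, form w (y i) = form w' (y i)) → w = w' := by
    intro y hy w w' h
    refine sub_eq_zero.1 (eq_zero_of_form_eq_zero fun v => ?_)
    have hv : v ∈ Submodule.span ℂ (Set.range y) := hy ▸ Submodule.mem_top
    induction hv using Submodule.span_induction with
    | mem v hv => obtain ⟨j, rfl⟩ := hv; rw [form_sub_left, h, sub_self]
    | zero => simp
    | add v v' _ _ h h' => rw [form_add_right, h, h', add_zero]
    | smul a v _ h => rw [form_smul_right, h, mul_zero]
  -- `σ v` is determined by its products with the `y i`, so linear relations within the families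
  -- cause no trouble.
  choose σ hσ using key x y hx hxy
  choose τ hτ using key y x hy (fun i j => (hxy j i).symm)
  have hform : ∀ u v, form (σ u) (σ v) = form v u := by
    intro u v
    have hu : u ∈ Submodule.span ℂ (Set.range x) := hx ▸ Submodule.mem_top
    have hσx : ∀ j, σ (x j) = y j := fun j => ext y hy _ _ fun i => by rw [hσ, hxy]
    have hadd : ∀ u u', σ (u + u') = σ u + σ u' := fun u u' => ext y hy _ _ fun i => by
      rw [form_add_left, hσ, hσ, hσ, form_add_right]
    have hsmul : ∀ (a : ℂ) u, σ (a • u) = star a • σ u := fun a u => ext y hy _ _ fun i => by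
      rw [form_smul_left, hσ, hσ, form_smul_right]
    have hzero : σ 0 = 0 := by simpa using hsmul 0 0
    induction hu using Submodule.span_induction with
    | mem u h => obtain ⟨j, rfl⟩ := h; rw [hσx, ← star_form, hσ, star_form]
    | zero => simp [hzero]
    | add u u' _ _ h h' => rw [hadd, form_add_left, h, h', form_add_right]
    | smul a u _ h => rw [hsmul, form_smul_left, h, form_smul_right]
  refine ⟨σ, hσ, hform, ?_, fun w => ⟨τ w, ext y hy _ _ fun i => ?_⟩⟩
  · intro u u' h
    refine ext x hx _ _ fun i => ?_
    rw [← star_form, ← hσ, h, hσ, star_form]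
  · rw [hσ, ← star_form, hτ, star_form]

/-- Every unitary automorphism is conjugate to its inverse by an antiunitary map. -/
theorem exists_antiunitary_conj_inv (A : (Fin (n + 1) → ℂ) ≃ₗ[ℂ] (Fin (n + 1) → ℂ))
    (hA : A ∈ unitary n) :
    ∃ σ : (Fin (n + 1) → ℂ) → Fin (n + 1) → ℂ,
      (∀ u v, form (σ u) (σ v) = form v u) ∧ Function.Bijective σ ∧
      ∀ v, σ (A v) = A⁻¹ (σ v) := by
  obtain ⟨E, hE, hspan⟩ := exists_orthogonal_cyclic_spanning A hA
  have hrange : Set.range (fun i : ℤ × E => (A ^ (-i.1)) (i.2 : Fin (n + 1) → ℂ)) =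
      Set.range fun i : ℤ × E => (A ^ i.1) (i.2 : Fin (n + 1) → ℂ) := by
    ext v
    constructor <;> rintro ⟨⟨m, e⟩, rfl⟩ <;> exact ⟨(-m, e), by simp⟩
  have hshift : ∀ (k m : ℤ) (u v : Fin (n + 1) → ℂ),
      form ((A ^ k) u) ((A ^ m) v) = form ((A ^ (k - m)) u) v := fun k m u v => by
    have := form_inv_right (zpow_mem hA (-m)) ((A ^ k) u) v
    rw [← zpow_neg, neg_neg, ← LinearEquiv.mul_apply, ← zpow_add] at this
    rw [this, neg_add_eq_sub]
  obtain ⟨σ, hσ, hform, hbij⟩ := exists_antiunitary_of_gram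
    (fun i : ℤ × E => (A ^ i.1) (i.2 : Fin (n + 1) → ℂ)) (fun i => (A ^ (-i.1)) i.2)
    hspan (hrange ▸ hspan) (by
      rintro ⟨k, e, he⟩ ⟨m, e', he'⟩
      simp only [hshift]
      by_cases h : e = e'
      · subst h
        congr 3
        ring
      · rw [hE e he e' he' h, hE e' he' e he (Ne.symm h)])
  refine ⟨σ, hform, hbij, fun v => ?_⟩
  refine sub_eq_zero.1 (eq_zero_of_form_eq_zero fun u => ?_)
  have hu : u ∈ Submodule.span ℂ (Set.range fun i : ℤ × E =>
    (A ^ (-i.1)) (i.2 : Fin (n + 1) → ℂ)) := by rw [hrange, hspan]; trivial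
  induction hu using Submodule.span_induction with
  | mem u hu =>
    obtain ⟨⟨m, e⟩, rfl⟩ := hu
    have h1 := hσ (A v) (m, e)
    -- The shift by one: `⟨A⁻¹σv, A⁻ᵐe⟩ = ⟨σv, A¹⁻ᵐe⟩ = ⟨Aᵐ⁻¹e, v⟩ = ⟨Aᵐe, Av⟩ = ⟨σAv, A⁻ᵐe⟩`.
    have h2 := hσ v (m - 1, e)
    have h3 := hA (A⁻¹ (σ v)) ((A ^ (-m)) e)
    have h4 := hA ((A ^ (m - 1)) e) v
    simp only [← LinearEquiv.mul_apply, ← zpow_one_add, mul_inv_cancel] at h1 h2 h3 h4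
    rw [form_sub_left, sub_eq_zero, h1, ← h3]
    rw [show -(m - 1) = 1 + -m by ring] at h2
    rw [show (1 + (m - 1)) = m by ring] at h4
    rw [LinearEquiv.coe_one, id, h2, ← h4]
  | zero => simp
  | add v v' _ _ h h' => rw [form_add_right, h, h', add_zero]
  | smul a v _ h => rw [form_smul_right, h, mul_zero]

/-! ### Unitary square roots inverted by the antiunitary map -/

theorem eq_of_forall_form_eq {σ : (Fin (n + 1) → ℂ) → Fin (n + 1) → ℂ}
    (hσ : Function.Surjective σ) {w w' : Fin (n + 1) → ℂ}
    (h : ∀ u, form w (σ u) = form w' (σ u)) : w = w' :=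
  sub_eq_zero.1 <| eq_zero_of_form_eq_zero fun y => by
    obtain ⟨u, rfl⟩ := hσ y
    rw [form_sub_left, h, sub_self]

theorem antiunitary_add {σ : (Fin (n + 1) → ℂ) → Fin (n + 1) → ℂ}
    (hσ : Function.Surjective σ) (hform : ∀ u v, form (σ u) (σ v) = form v u)
    (u v : Fin (n + 1) → ℂ) : σ (u + v) = σ u + σ v :=
  eq_of_forall_form_eq hσ fun w => by simp only [form_add_left, form_add_right, hform]

theorem antiunitary_smul {σ : (Fin (n + 1) → ℂ) → Fin (n + 1) → ℂ}
    (hσ : Function.Surjective σ) (hform : ∀ u v, form (σ u) (σ v) = form v u)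
    (a : ℂ) (v : Fin (n + 1) → ℂ) : σ (a • v) = star a • σ v :=
  eq_of_forall_form_eq hσ fun w => by simp only [form_smul_left, form_smul_right, hform]

theorem form_aeval_left {A : (Fin (n + 1) → ℂ) ≃ₗ[ℂ] (Fin (n + 1) → ℂ)} (hA : A ∈ unitary n)
    (p : ℂ[X]) (x y : Fin (n + 1) → ℂ) :
    form (aeval A.toLinearMap p x) y =
      form x (aeval (A⁻¹).toLinearMap (p.map (starRingEnd ℂ)) y) := by
  induction p using Polynomial.induction_on generalizing x y with
  | C a => simp [Module.algebraMap_end_apply, form_smul_left, form_smul_right]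
  | add p q hp hq => simp [form_add_left, form_add_right, hp, hq]
  | monomial k a h =>
    rw [pow_succ, ← mul_assoc]
    generalize C a * X ^ k = q at h ⊢
    rw [map_mul, aeval_X, Module.End.mul_apply, h, Polynomial.map_mul,
      map_X, mul_comm _ X, map_mul, aeval_X, Module.End.mul_apply]
    exact (form_inv_right hA _ _).symm

theorem antiunitary_aeval {A : (Fin (n + 1) → ℂ) ≃ₗ[ℂ] (Fin (n + 1) → ℂ)}
    {σ : (Fin (n + 1) → ℂ) → Fin (n + 1) → ℂ}
    (hσ : Function.Surjective σ) (hform : ∀ u v, form (σ u) (σ v) = form v u)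
    (hσA : ∀ v, σ (A v) = A⁻¹ (σ v)) (p : ℂ[X]) (v : Fin (n + 1) → ℂ) :
    σ (aeval A.toLinearMap p v) = aeval (A⁻¹).toLinearMap (p.map (starRingEnd ℂ)) (σ v) := by
  induction p using Polynomial.induction_on generalizing v with
  | C a => simp [Module.algebraMap_end_apply, antiunitary_smul hσ hform]
  | add p q hp hq => simp [antiunitary_add hσ hform, hp, hq]
  | monomial k a h =>
    rw [pow_succ, ← mul_assoc]
    generalize C a * X ^ k = q at h ⊢
    rw [map_mul, aeval_X, Module.End.mul_apply, h, Polynomial.map_mul,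
      map_X, map_mul, aeval_X, Module.End.mul_apply]
    exact congrArg _ (hσA v)

theorem cpow_half_sq (μ : ℂ) : (μ ^ (1 / 2 : ℂ)) ^ 2 = μ := by
  rw [← Complex.cpow_nat_mul]; norm_num

/-- `μ` and `1/μ̄` have the same argument, so the principal branch treats them alike, even on the
negative real axis. This is needed because eigenvalues off the unit circle can occur. -/
theorem cpow_half_mul_star {μ : ℂ} (hμ : μ ≠ 0) :
    μ ^ (1 / 2 : ℂ) * star ((star μ)⁻¹ ^ (1 / 2 : ℂ)) = 1 := by
  have h0 : (star μ)⁻¹ ≠ 0 := inv_ne_zero (star_ne_zero.2 hμ)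
  have harg : (star μ)⁻¹.arg = μ.arg := by
    have h1 : (star μ)⁻¹ = ((‖μ‖ ^ 2)⁻¹ : ℝ) * μ := by
      have h2 : star μ ≠ 0 := star_ne_zero.2 hμ
      have h3 : star μ * μ = ((‖μ‖ ^ 2 : ℝ) : ℂ) := by simpa using Complex.conj_mul' μ
      rw [Complex.ofReal_inv, ← h3]
      field_simp
    rw [h1, Complex.arg_real_mul _ (by positivity)]
  have hlog : star (Complex.log (star μ)⁻¹) = -Complex.log μ := by
    apply Complex.ext
    · simp [Complex.log_re]
    · simp only [Complex.star_def, Complex.conj_im, Complex.log_im, Complex.neg_im]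
      rw [← Complex.star_def, harg]
  rw [Complex.cpow_def_of_ne_zero hμ, Complex.cpow_def_of_ne_zero h0, Complex.star_def,
    ← Complex.exp_conj, ← Complex.exp_add, Complex.exp_eq_one_iff]
  refine ⟨0, ?_⟩
  rw [map_mul, ← Complex.star_def, hlog]
  simp

/-- With `C = p(A)`, the operator `D = p̄(A⁻¹)` is both the adjoint of `C` and its conjugate under
`σ`. Unitarity and `σ C = C⁻¹ σ` therefore both reduce to `C D = 1`. -/
theorem exists_unitary_sqrt {A : (Fin (n + 1) → ℂ) ≃ₗ[ℂ] (Fin (n + 1) → ℂ)} (hA : A ∈ unitary n)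
    {σ : (Fin (n + 1) → ℂ) → Fin (n + 1) → ℂ} (hσ : Function.Bijective σ)
    (hform : ∀ u v, form (σ u) (σ v) = form v u) (hσA : ∀ v, σ (A v) = A⁻¹ (σ v)) :
    ∃ C ∈ unitary n, C * C = A ∧ ∀ v, σ (C v) = C⁻¹ (σ v) := by
  have hroot : (minpoly ℂ A.toLinearMap).eval 0 ≠ 0 := fun h => by
    obtain ⟨v, hv⟩ := (Module.End.hasEigenvalue_of_isRoot h).exists_hasEigenvector
    have := hv.apply_eq_smul
    rw [zero_smul] at this
    exact hv.2 (A.map_eq_zero_iff.1 this)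
  obtain ⟨p, ⟨q, hq⟩, hp⟩ := exists_sqrt_X_mod (minpoly ℂ A.toLinearMap) hroot
    (fun μ => μ ^ (1 / 2 : ℂ)) cpow_half_sq
  set C : Module.End ℂ (Fin (n + 1) → ℂ) := aeval A.toLinearMap p with hC
  set D : Module.End ℂ (Fin (n + 1) → ℂ) :=
    aeval (A⁻¹).toLinearMap (p.map (starRingEnd ℂ)) with hD
  have hCC : C * C = A.toLinearMap := by
    have := congrArg (aeval A.toLinearMap) hq
    rw [map_mul, minpoly.aeval, zero_mul, map_sub, map_pow, aeval_X, sub_eq_zero] at this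
    rw [← this, sq]
  have hadj : ∀ x y, form (C x) y = form x (D y) := form_aeval_left hA p
  have hDD : ∀ y, D (D y) = A⁻¹ y := fun y => by
    have : ∀ x, form x (D (D y)) = form x (A⁻¹ y) := fun x => by
      rw [← hadj, ← hadj, form_inv_right hA]
      exact congrArg (form · y) (LinearMap.congr_fun hCC x)
    refine sub_eq_zero.1 (eq_zero_of_form_eq_zero fun x => ?_)
    rw [← star_form, form_sub_right, this, sub_self, star_zero]
  have hAA : Commute A.toLinearMap (A⁻¹).toLinearMap := LinearMap.ext fun v => by
    change (A * A⁻¹) v = (A⁻¹ * A) v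
    simp
  have hAD : Commute A.toLinearMap D := by
    rw [hD, aeval_eq_sum_range]
    exact Commute.sum_right _ _ _ fun i _ => (hAA.pow_right i).smul_right _
  have hAC : Commute A.toLinearMap C := by
    rw [hC, aeval_eq_sum_range]
    exact Commute.sum_right _ _ _ fun i _ => ((Commute.refl _).pow_right i).smul_right _
  have hCD : Commute C D := by
    rw [hC, aeval_eq_sum_range]
    exact Commute.sum_left _ _ _ fun i _ => (hAD.pow_left i).smul_left _
  have hsq : (C * D) * (C * D) = 1 := by
    rw [← mul_assoc, mul_assoc C D C, ← hCD.eq, ← mul_assoc, hCC]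
    refine LinearMap.ext fun v => ?_
    simp only [Module.End.mul_apply, hDD]
    change (A * A⁻¹) v = v
    simp
  have heig : ∀ (μ : ℂ) (v : Fin (n + 1) → ℂ), v ≠ 0 → A v = μ • v → C v = (μ ^ (1 / 2 : ℂ)) • v := by
    intro μ v hv hAv
    have h : Module.End.HasEigenvector A.toLinearMap μ v :=
      Module.End.hasEigenvector_iff.2 ⟨Module.End.mem_eigenspace_iff.2 hAv, hv⟩
    rw [hC, Module.End.aeval_apply_of_hasEigenvector h,
      hp μ (Module.End.isRoot_of_hasEigenvalue (Module.End.hasEigenvalue_of_hasEigenvector h))]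
  have hσ0 : σ 0 = 0 := by simpa using antiunitary_smul hσ.2 hform 0 0
  -- `v = σ u` with `u` an eigenvector for `1/μ̄`; the action of `D` on `v` is transported from that
  -- of `C` on `u`.
  have heigD : ∀ (μ : ℂ) (v : Fin (n + 1) → ℂ), v ≠ 0 → A v = μ • v →
      D v = star ((star μ)⁻¹ ^ (1 / 2 : ℂ)) • v := by
    intro μ v hv hAv
    have hμ : μ ≠ 0 := by
      rintro rfl
      rw [zero_smul] at hAv
      exact hv (A.map_eq_zero_iff.1 hAv)
    obtain ⟨u, rfl⟩ := hσ.2 v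
    have hu : u ≠ 0 := by rintro rfl; exact hv hσ0
    have hAu : A u = (star μ)⁻¹ • u := by
      apply hσ.1
      rw [hσA, antiunitary_smul hσ.2 hform, star_inv₀, star_star, eq_inv_smul_iff₀ hμ, ← map_smul,
        ← hAv]
      change (A⁻¹ * A) _ = _
      simp
    rw [hD, ← antiunitary_aeval hσ.2 hform hσA, ← hC, heig _ u hu hAu,
      antiunitary_smul hσ.2 hform]
  have hCD1 : C * D = 1 := by
    -- `(C D)² = 1`, so only the eigenvalue `-1` must be excluded. Its eigenspace is `A`-invariant;
    -- if nonzero it would contain an eigenvector of `A`, on which `C D` acts as `1`.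
    have hker : LinearMap.ker (C * D + 1) = ⊥ := by
      by_contra hbot
      have hinv : ∀ v ∈ LinearMap.ker (C * D + 1), A.toLinearMap v ∈ LinearMap.ker (C * D + 1) := by
        intro v hv
        have hcomm : Commute A.toLinearMap (C * D + 1) :=
          (hAC.mul_right hAD).add_right (Commute.one_right _)
        rw [LinearMap.mem_ker] at hv ⊢
        rw [← Module.End.mul_apply, ← hcomm.eq, Module.End.mul_apply, hv, map_zero]
      have : Nontrivial (LinearMap.ker (C * D + 1)) := Submodule.nontrivial_iff_ne_bot.2 hbot
      obtain ⟨μ, hμ⟩ := Module.End.exists_eigenvalue (A.toLinearMap.restrict hinv)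
      obtain ⟨⟨v, hv⟩, hv'⟩ := hμ.exists_hasEigenvector
      have hv0 : v ≠ 0 := fun h => hv'.2 (Subtype.ext h)
      have hAv : A v = μ • v := congrArg Subtype.val hv'.apply_eq_smul
      have hμ0 : μ ≠ 0 := by
        rintro rfl
        rw [zero_smul] at hAv
        exact hv0 (A.map_eq_zero_iff.1 hAv)
      rw [LinearMap.mem_ker, LinearMap.add_apply, Module.End.mul_apply, heigD μ v hv0 hAv,
        map_smul, heig μ v hv0 hAv, smul_smul, mul_comm, cpow_half_mul_star hμ0] at hv
      rw [one_smul, Module.End.one_apply, ← two_smul ℂ v] at hv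
      exact hv0 ((smul_eq_zero.1 hv).resolve_left two_ne_zero)
    have hmul : (C * D + 1) * (C * D - 1) = 0 := by
      rw [mul_sub, add_mul, hsq]; simp [add_comm]
    refine sub_eq_zero.1 (LinearMap.ext fun v => ?_)
    have := LinearMap.congr_fun hmul v
    rw [Module.End.mul_apply, LinearMap.zero_apply] at this
    exact LinearMap.ker_eq_bot'.1 hker _ this
  have hDC1 : D * C = 1 := by rw [← hCD.eq, hCD1]
  refine ⟨LinearEquiv.ofLinearMap C D hCD1 hDC1, fun x y => ?_, ?_, fun v => ?_⟩
  · change form (C x) (C y) = _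
    rw [hadj]
    exact congrArg (form x) (LinearMap.congr_fun hDC1 y)
  · exact LinearEquiv.ext fun v => LinearMap.congr_fun hCC v
  · change σ (C v) = D (σ v)
    exact antiunitary_aeval hσ.2 hform hσA p v

/-! ### Isometries induced by unitary and antiunitary maps -/

theorem ne_zero_of_quad_neg {v : Fin (n + 1) → ℂ} (hv : quad v < 0) : v ≠ 0 := by
  rintro rfl
  simp [quad] at hv

/-- The point of complex hyperbolic space spanned by a negative vector. -/
noncomputable def point (v : Fin (n + 1) → ℂ) (hv : quad v < 0) : Space n :=
  ⟨Projectivization.mk ℂ v (ne_zero_of_quad_neg hv), (quad_rep_mk_neg_iff _ _).2 hv⟩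

theorem point_eq_of_smul {a : ℂ} {v w : Fin (n + 1) → ℂ} (h : v = a • w) (hv : quad v < 0)
    (hw : quad w < 0) : point v hv = point w hw :=
  Subtype.ext ((Projectivization.mk_eq_mk_iff' ℂ v w _ _).2 ⟨a, h.symm⟩)

theorem point_congr {v w : Fin (n + 1) → ℂ} (h : v = w) (hv : quad v < 0)
    (hw : quad w < 0) : point v hv = point w hw :=
  point_eq_of_smul (a := 1) (by rw [h, one_smul]) hv hw

theorem point_rep (p : Space n) : point p.1.rep p.2 = p := Subtype.ext p.1.mk_rep

theorem hdist_point (v w : Fin (n + 1) → ℂ) (hv : quad v < 0) (hw : quad w < 0) :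
    hdist (point v hv) (point w hw) =
      2 * Real.arcosh (‖form v w‖ / Real.sqrt (quad v * quad w)) :=
  hdist_mk _ _ _ _ _ _

theorem exists_rep_point (v : Fin (n + 1) → ℂ) (hv : quad v < 0) :
    ∃ a : ℂ, (point v hv).1.rep = a • v := by
  obtain ⟨a, ha⟩ := Projectivization.exists_smul_eq_mk_rep ℂ v (ne_zero_of_quad_neg hv)
  exact ⟨a, ha.symm⟩

/-- A bijection of `ℂ^{n,1}` is unitary or antiunitary. -/
def PreservesForm (T : Equiv.Perm (Fin (n + 1) → ℂ)) : Prop :=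
  (∀ x y, form (T x) (T y) = form x y) ∨ ∀ x y, form (T x) (T y) = form y x

namespace PreservesForm

variable {T : Equiv.Perm (Fin (n + 1) → ℂ)}

theorem symm (hT : PreservesForm T) : PreservesForm T.symm := by
  refine hT.imp (fun h x y => ?_) (fun h x y => ?_)
  · rw [← h, T.apply_symm_apply, T.apply_symm_apply]
  · rw [← h, T.apply_symm_apply, T.apply_symm_apply]

theorem exists_smul (hT : PreservesForm T) (a : ℂ) (v : Fin (n + 1) → ℂ) :
    ∃ b : ℂ, T (a • v) = b • T v := by
  rcases hT with h | h
  · exact ⟨a, eq_of_forall_form_eq T.surjective fun u => by simp only [h, form_smul_left]⟩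
  · exact ⟨star a, antiunitary_smul T.surjective h a v⟩

theorem quad_apply (hT : PreservesForm T) (v : Fin (n + 1) → ℂ) : quad (T v) = quad v := by
  rcases hT with h | h <;> rw [quad, h, quad]

theorem norm_form (hT : PreservesForm T) (v w : Fin (n + 1) → ℂ) :
    ‖form (T v) (T w)‖ = ‖form v w‖ := by
  rcases hT with h | h
  · rw [h]
  · rw [h, ← star_form, norm_star]

/-- The action of a unitary or antiunitary bijection on points. -/
noncomputable def onSpace (hT : PreservesForm T) (p : Space n) : Space n :=
  point (T p.1.rep) (by rw [hT.quad_apply]; exact p.2)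

theorem onSpace_point (hT : PreservesForm T) (v : Fin (n + 1) → ℂ) (hv : quad v < 0) :
    hT.onSpace (point v hv) = point (T v) (by rwa [hT.quad_apply]) := by
  obtain ⟨a, ha⟩ := exists_rep_point v hv
  obtain ⟨b, hb⟩ := hT.exists_smul a v
  exact point_eq_of_smul (a := b) (by rw [ha, hb]) _ _

theorem onSpace_symm_onSpace (hT : PreservesForm T) (p : Space n) :
    hT.symm.onSpace (hT.onSpace p) = p := by
  rw [← point_rep p, onSpace_point, onSpace_point]
  exact point_congr (T.symm_apply_apply _) _ _

/-- The isometry of complex hyperbolic space induced by a unitary or antiunitary bijection. -/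
noncomputable def toIsom (hT : PreservesForm T) : Isom n :=
  ⟨⟨hT.onSpace, hT.symm.onSpace, hT.onSpace_symm_onSpace, hT.symm.onSpace_symm_onSpace⟩,
    fun p q => by
      change hdist (hT.onSpace p) (hT.onSpace q) = _
      rw [← point_rep p, ← point_rep q, onSpace_point, onSpace_point, hdist_point, hdist_point,
        hT.norm_form, hT.quad_apply, hT.quad_apply]⟩

theorem toIsom_point (hT : PreservesForm T) (v : Fin (n + 1) → ℂ) (hv : quad v < 0) :
    (hT.toIsom : Equiv.Perm (Space n)) (point v hv) = point (T v) (by rwa [hT.quad_apply]) :=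
  hT.onSpace_point v hv

end PreservesForm

/-- An isometry induced by a unitary automorphism is a commutator. -/
theorem exists_commutator_of_unitary (f : Isom n)
    {A : (Fin (n + 1) → ℂ) ≃ₗ[ℂ] (Fin (n + 1) → ℂ)} (hA : A ∈ unitary n)
    (hf : ∀ (v : Fin (n + 1) → ℂ) (hv : quad v < 0) (hv' : quad (A v) < 0),
      (f : Equiv.Perm (Space n)) (point v hv) = point (A v) hv') :
    ∃ α β : Isom n, f = α * β * α⁻¹ * β⁻¹ := by
  obtain ⟨σ, hform, hσ, hσA⟩ := exists_antiunitary_conj_inv A hA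
  obtain ⟨C, hC, rfl, hσC⟩ := exists_unitary_sqrt hA hσ hform hσA
  have hα : PreservesForm (C.toEquiv : Equiv.Perm (Fin (n + 1) → ℂ)) := Or.inl hC
  have hβ : PreservesForm (Equiv.ofBijective σ hσ) := Or.inr hform
  refine ⟨hα.toIsom, hβ.toIsom, ?_⟩
  rw [eq_mul_inv_iff_mul_eq, eq_mul_inv_iff_mul_eq]
  refine Subtype.ext (Equiv.ext fun p => ?_)
  rw [← point_rep p]
  have hq : ∀ v, quad ((C * C) v) = quad v := fun v => by rw [quad, hA, quad]
  change (f : Equiv.Perm (Space n)) ((hβ.toIsom : Equiv.Perm (Space n))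
    ((hα.toIsom : Equiv.Perm (Space n)) _)) = (hα.toIsom : Equiv.Perm (Space n))
    ((hβ.toIsom : Equiv.Perm (Space n)) _)
  have hp := p.2
  rw [hα.toIsom_point, hβ.toIsom_point, hβ.toIsom_point, hα.toIsom_point,
    hf _ _ (by rwa [hq, hβ.quad_apply, hα.quad_apply])]
  refine point_congr ?_ _ _
  change C (C (σ (C _))) = C (σ _)
  rw [hσC]
  congr 1
  change (C * C⁻¹) _ = _
  simp

/-! ### Holomorphic isometries are induced by unitary maps -/

/-- A holomorphic map with the Gram moduli of the ball, based at the origin, is linear. -/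
theorem eq_linear_of_norm_form_eq {u₀ : Fin (n + 1) → ℂ} (hu₀ : quad u₀ < 0)
    {y : EuclideanSpace ℂ (Fin n) → Fin (n + 1) → ℂ} (hy : DifferentiableAt ℂ y 0) (hy0 : y 0 = 0)
    (hyu : ∀ z, ‖z‖ < 1 → form (y z) u₀ = 0) (hquad : ∀ z, ‖z‖ < 1 → quad (y z) = ‖z‖ ^ 2)
    (hnorm : ∀ z z', ‖z‖ < 1 → ‖z'‖ < 1 → ‖-1 + form (y z) (y z')‖ = ‖-1 + inner ℂ z' z‖) :
    ∃ L : EuclideanSpace ℂ (Fin n) →ₗ[ℂ] Fin (n + 1) → ℂ,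
      (∀ z w, form (L z) (L w) = inner ℂ w z) ∧ (∀ z, form (L z) u₀ = 0) ∧
      ∀ z, ‖z‖ < 1 → y z = L z := by
  set L := fderiv ℂ y 0 with hL
  have hder : ∀ (w : EuclideanSpace ℂ (Fin n)) (x : Fin (n + 1) → ℂ),
      HasDerivAt (fun t : ℂ => form (y (t • w)) x) (form (L w) x) 0 := by
    intro w x
    have h1 : HasDerivAt (fun t : ℂ => t • w) w 0 := by
      simpa using (hasDerivAt_id (0 : ℂ)).smul_const w
    have h2 : HasFDerivAt y L ((0 : ℂ) • w) := by
      rw [zero_smul]; exact hy.hasFDerivAt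
    exact (formLeft x).toContinuousLinearMap.hasFDerivAt.comp_hasDerivAt (0 : ℂ)
      (h2.comp_hasDerivAt (0 : ℂ) h1)
  have hball : ∀ w : EuclideanSpace ℂ (Fin n), ∀ᶠ t : ℂ in nhds 0, ‖t • w‖ < 1 := by
    intro w
    have : Continuous fun t : ℂ => ‖t • w‖ := by fun_prop
    exact this.continuousAt.eventually_lt continuousAt_const (by simp)
  -- Differentiate the squared modulus in `hnorm` along `t • w` at real `t = 0`: since `y 0 = 0`,
  -- only the real parts of the linear terms survive.
  have hre : ∀ z w, ‖z‖ < 1 → (form (L w) (y z)).re = (inner ℂ z w).re := by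
    intro z w hz
    have h1 : HasDerivAt (fun t : ℝ => -1 + form (y ((t : ℂ) • w)) (y z)) (form (L w) (y z)) 0 :=
      (HasDerivAt.comp_ofReal (z := 0) (by simpa using hder w (y z))).const_add _
    have h2 : HasDerivAt (fun t : ℝ => -1 + (t : ℂ) * inner ℂ z w) (inner ℂ z w) 0 := by
      have := ((hasDerivAt_id (0 : ℂ)).mul_const (inner ℂ z w))
      rw [one_mul] at this
      exact (HasDerivAt.comp_ofReal (z := 0) (by simpa using this)).const_add _
    have h3 : (fun t : ℝ => ‖-1 + form (y ((t : ℂ) • w)) (y z)‖ ^ 2) =ᶠ[nhds 0]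
        fun t : ℝ => ‖-1 + (t : ℂ) * inner ℂ z w‖ ^ 2 := by
      have hc : Filter.Tendsto (fun t : ℝ => (t : ℂ)) (nhds 0) (nhds 0) := by
        simpa using Complex.continuous_ofReal.tendsto 0
      filter_upwards [hc.eventually (hball w)] with t ht
      rw [hnorm _ _ ht hz, inner_smul_right]
    have h4 := (h1.norm_sq.congr_of_eventuallyEq h3.symm).unique h2.norm_sq
    simp [hy0, Complex.inner] at h4
    exact h4
  -- Complex linearity of `L`, which is where holomorphy enters, recovers the imaginary part on
  -- replacing `w` by `i w`.
  have hLy : ∀ z w, ‖z‖ < 1 → form (L w) (y z) = inner ℂ z w := by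
    intro z w hz
    refine Complex.ext (hre z w hz) ?_
    have := hre z (Complex.I • w) hz
    rw [map_smul, form_smul_left, inner_smul_right] at this
    simpa using this
  have hLL : ∀ z w, form (L z) (L w) = inner ℂ w z := by
    intro z w
    have h1 : HasDerivAt (fun t : ℂ => t * inner ℂ w z) (inner ℂ w z) 0 := by
      simpa using (hasDerivAt_id (0 : ℂ)).mul_const (inner ℂ w z)
    refine (HasDerivAt.congr_of_eventuallyEq (hder z (L w)) ?_).unique h1
    filter_upwards [hball z] with t ht
    rw [← star_form, hLy _ _ ht, ← inner_smul_right, Complex.star_def, inner_conj_symm]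
  have hLu : ∀ z, form (L z) u₀ = 0 := by
    intro z
    refine (HasDerivAt.congr_of_eventuallyEq (hder z u₀) ?_).unique (hasDerivAt_const (0 : ℂ) (0 : ℂ))
    filter_upwards [hball z] with t ht
    rw [hyu _ ht]
  refine ⟨L, hLL, hLu, fun z hz => ?_⟩
  -- All four products in the expansion of `⟨y z - L z, y z - L z⟩` equal `‖z‖²`, so the difference
  -- is isotropic in the positive definite complement of `u₀`.
  refine sub_eq_zero.1 (eq_zero_of_form_eq_zero_of_quad hu₀ (x := y z - L z) ?_ (le_of_eq ?_))
  · rw [form_sub_left, hyu z hz]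
    simpa using hLu z
  · have h1 : form (y z) (L z) = (‖z‖ ^ 2 : ℝ) := by
      rw [← star_form, hLy z z hz, inner_self_eq_norm_sq_to_K]; simp
    have h2 : form (y z - L z) (y z - L z) = 0 := by
      rw [form_sub_left, form_sub_right, form_sub_right, form_self, hquad z hz, h1, hLy z z hz, hLL,
        inner_self_eq_norm_sq_to_K]
      simp
    simpa [quad] using congrArg Complex.re h2

theorem form_ne_zero {v w : Fin (n + 1) → ℂ} (hv : quad v < 0) (hw : quad w < 0) :
    form v w ≠ 0 := fun h =>
  ne_zero_of_quad_neg hv (eq_zero_of_form_eq_zero_of_quad hw h hv.le)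

theorem norm_form_sq_eq_of_hdist_eq {v w v' w' : Fin (n + 1) → ℂ} (hv : quad v < 0)
    (hw : quad w < 0) (hv' : quad v' < 0) (hw' : quad w' < 0)
    (h : hdist (point v hv) (point w hw) = hdist (point v' hv') (point w' hw')) :
    ‖form v w‖ ^ 2 * (quad v' * quad w') = ‖form v' w'‖ ^ 2 * (quad v * quad w) := by
  rw [hdist_point, hdist_point] at h
  have h1 := mul_pos_of_neg_of_neg hv hw
  have h2 := mul_pos_of_neg_of_neg hv' hw'
  have h3 := norm_pos_iff.2 (form_ne_zero hv hw)
  have h4 := norm_pos_iff.2 (form_ne_zero hv' hw')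
  -- Injectivity is available on all positive reals, so the reverse Cauchy–Schwarz bound (ratio at
  -- least `1`) is not needed.
  have h5 := Real.strictMonoOn_arcosh.injOn (Set.mem_Ioi.2 (by positivity))
    (Set.mem_Ioi.2 (by positivity)) (mul_left_cancel₀ two_ne_zero h)
  have h6 := congrArg (· ^ 2) h5
  simp only [div_pow, Real.sq_sqrt h1.le, Real.sq_sqrt h2.le] at h6
  rwa [div_eq_div_iff h1.ne' h2.ne'] at h6

/-- The vector `(1, z)` spanning the point with ball coordinates `z`. -/
def lift (z : EuclideanSpace ℂ (Fin n)) : Fin (n + 1) → ℂ := Fin.cons 1 z.ofLp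

theorem form_lift (z w : EuclideanSpace ℂ (Fin n)) :
    form (lift z) (lift w) = -1 + inner ℂ w z := by
  simp [form, lift, PiLp.inner_apply]

theorem quad_lift (z : EuclideanSpace ℂ (Fin n)) : quad (lift z) = -1 + ‖z‖ ^ 2 := by
  rw [quad, form_lift, inner_self_eq_norm_sq_to_K]
  simp [← Complex.ofReal_pow]

theorem quad_lift_neg {z : EuclideanSpace ℂ (Fin n)} (hz : ‖z‖ < 1) : quad (lift z) < 0 := by
  rw [quad_lift]
  have := (sq_lt_one_iff₀ (norm_nonneg z)).2 hz
  linarith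

theorem ballCoord_point_lift {z : EuclideanSpace ℂ (Fin n)} (hz : quad (lift z) < 0) :
    ballCoord (point (lift z) hz) = z := by
  refine (ballCoord_mk _ _ _).trans ?_
  simp [lift]

theorem norm_ballCoord_lt (p : Space n) : ‖ballCoord p‖ < 1 := by
  simpa [range_ballCoord] using Set.mem_range_self (f := ballCoord) p

theorem differentiable_lift : Differentiable ℂ (lift (n := n)) := by
  rw [differentiable_pi]
  refine Fin.cases ?_ fun i => ?_
  · simp [lift]
  · simp only [lift, Fin.cons_succ]
    fun_prop

/-- Every holomorphic isometry is induced by a unitary automorphism. -/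
theorem exists_unitary_of_isHolomorphic (f : Isom n)
    (hf : IsHolomorphic (f : Equiv.Perm (Space n))) :
    ∃ A ∈ unitary n, ∀ (v : Fin (n + 1) → ℂ) (hv : quad v < 0) (hv' : quad (A v) < 0),
      (f : Equiv.Perm (Space n)) (point v hv) = point (A v) hv' := by
  obtain ⟨F, hF, hfF⟩ := hf
  have hFd : DifferentiableAt ℂ F 0 :=
    hF.differentiableAt (Metric.ball_mem_nhds _ one_pos)
  have hF1 : ∀ z, ‖z‖ < 1 → ‖F z‖ < 1 := fun z hz => by
    rw [← ballCoord_point_lift (quad_lift_neg hz), ← hfF]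
    exact norm_ballCoord_lt _
  have hfl : ∀ z (hz : ‖z‖ < 1), (f : Equiv.Perm (Space n)) (point (lift z) (quad_lift_neg hz)) =
      point (lift (F z)) (quad_lift_neg (hF1 z hz)) := fun z hz => ballCoord_injective <| by
    rw [hfF, ballCoord_point_lift, ballCoord_point_lift]
  have h01 : ‖(0 : EuclideanSpace ℂ (Fin n))‖ < 1 := by simp
  set v₀ := lift (F 0) with hv₀
  have hq₀ : quad v₀ < 0 := quad_lift_neg (hF1 0 h01)
  set c : ℝ := Real.sqrt (-quad v₀) with hc
  have hcpos : 0 < c := Real.sqrt_pos.2 (by linarith)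
  have hcsq : (c : ℂ) ^ 2 = -(quad v₀ : ℂ) := by
    rw [← Complex.ofReal_pow, hc, Real.sq_sqrt (by linarith), Complex.ofReal_neg]
  have hc0 : (c : ℂ) ≠ 0 := by exact_mod_cast hcpos.ne'
  -- Lift of `f` scaled so that `⟨u z, u 0⟩ = -1` for all `z`, matching `⟨(1,z),(1,0)⟩`. The scalar
  -- is holomorphic because the form is linear in its first argument.
  set u : EuclideanSpace ℂ (Fin n) → Fin (n + 1) → ℂ := fun z =>
    (-c / form (lift (F z)) v₀ : ℂ) • lift (F z) with hu
  have hform0 : ∀ z, ‖z‖ < 1 → form (lift (F z)) v₀ ≠ 0 := fun z hz =>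
    form_ne_zero (quad_lift_neg (hF1 z hz)) hq₀
  have hu0 : u 0 = (c : ℂ)⁻¹ • v₀ := by
    have h1 : (quad v₀ : ℂ) = -(c : ℂ) ^ 2 := by rw [hcsq, neg_neg]
    simp only [hu]
    rw [← hv₀, form_self, h1]
    congr 1
    field_simp
  have hquad_u : ∀ z, ‖z‖ < 1 → quad (u z) < 0 := fun z hz => by
    rw [hu, quad_smul]
    exact mul_neg_of_pos_of_neg
      (by have := div_ne_zero (neg_ne_zero.2 hc0) (hform0 z hz); positivity)
      (quad_lift_neg (hF1 z hz))
  have huu0 : ∀ z, ‖z‖ < 1 → form (u z) (u 0) = -1 := fun z hz => by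
    rw [hu0, hu, form_smul_smul]
    have := hform0 z hz
    simp only [star_inv₀, Complex.star_def, Complex.conj_ofReal]
    field_simp
  have hfu : ∀ z (hz : ‖z‖ < 1), (f : Equiv.Perm (Space n)) (point (lift z) (quad_lift_neg hz)) =
      point (u z) (hquad_u z hz) := fun z hz =>
    (hfl z hz).trans (point_eq_of_smul rfl _ _).symm
  have hrel : ∀ z z', ‖z‖ < 1 → ‖z'‖ < 1 →
      ‖form (u z) (u z')‖ ^ 2 * (quad (lift z) * quad (lift z')) =
        ‖form (lift z) (lift z')‖ ^ 2 * (quad (u z) * quad (u z')) := fun z z' hz hz' => by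
    refine norm_form_sq_eq_of_hdist_eq (hquad_u z hz) (hquad_u z' hz') (quad_lift_neg hz)
      (quad_lift_neg hz') ?_
    rw [← hfu z hz, ← hfu z' hz']
    exact f.2 _ _
  have hqu0 : quad (u 0) = -1 := by rw [quad, huu0 0 h01]; simp
  -- Comparison of the distances to the origin.
  have hqu : ∀ z, ‖z‖ < 1 → quad (u z) = -1 + ‖z‖ ^ 2 := fun z hz => by
    have h := hrel z 0 hz h01
    rw [huu0 z hz, form_lift, quad_lift, quad_lift, hqu0] at h
    simp at h
    linarith
  have hnorm : ∀ z z', ‖z‖ < 1 → ‖z'‖ < 1 → ‖form (u z) (u z')‖ = ‖-1 + inner ℂ z' z‖ := by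
    intro z z' hz hz'
    have h := hrel z z' hz hz'
    rw [hqu z hz, hqu z' hz', ← quad_lift, ← quad_lift, form_lift] at h
    have h' := mul_right_cancel₀
      (mul_pos_of_neg_of_neg (quad_lift_neg hz) (quad_lift_neg hz')).ne' h
    exact (pow_left_inj₀ (norm_nonneg _) (norm_nonneg _) two_ne_zero).1 h'
  have hu0u : ∀ z, ‖z‖ < 1 → form (u 0) (u z) = -1 := fun z hz => by
    rw [← star_form, huu0 z hz]; simp
  have hdiff : DifferentiableAt ℂ u 0 := by
    have h1 : DifferentiableAt ℂ (fun z => lift (F z)) 0 :=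
      differentiable_lift.differentiableAt.comp 0 hFd
    have h2 : DifferentiableAt ℂ (fun z => form (lift (F z)) v₀) 0 :=
      (formLeft v₀).toContinuousLinearMap.differentiableAt.comp 0 h1
    have h3 : DifferentiableAt ℂ (fun z => -(c : ℂ) / form (lift (F z)) v₀) 0 := by
      simpa only [div_eq_mul_inv] using (h2.fun_inv (hform0 0 h01)).const_mul (-(c : ℂ))
    exact h3.smul h1
  obtain ⟨L, hLL, hLu, hL⟩ := eq_linear_of_norm_form_eq (u₀ := u 0) (y := fun z => u z - u 0)
    (by rw [hqu0]; norm_num) (hdiff.sub_const _) (sub_self _)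
    (fun z hz => by rw [form_sub_left, huu0 z hz, huu0 0 h01, sub_self])
    (fun z hz => by
      have : form (u z - u 0) (u z - u 0) = (‖z‖ ^ 2 : ℝ) := by
        rw [form_sub_left, form_sub_right, form_sub_right, huu0 z hz, hu0u z hz, huu0 0 h01,
          form_self, hqu z hz]
        push_cast; ring
      rw [quad, this, Complex.ofReal_re])
    (fun z z' hz hz' => by
      rw [← hnorm z z' hz hz', form_sub_left, form_sub_right, form_sub_right, huu0 z hz,
        hu0u z' hz', huu0 0 h01]
      congr 1; ring)
  -- The linear extension of `(1, z) ↦ u 0 + L z = u z`.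
  let A₀ : (Fin (n + 1) → ℂ) →ₗ[ℂ] (Fin (n + 1) → ℂ) :=
    { toFun := fun x => x 0 • u 0 + L (WithLp.toLp 2 fun i : Fin n => x i.succ)
      map_add' := fun x y => by
        have : (WithLp.toLp 2 fun i : Fin n => (x + y) i.succ) =
          (WithLp.toLp 2 fun i : Fin n => x i.succ) + WithLp.toLp 2 fun i : Fin n => y i.succ := rfl
        rw [this, map_add, Pi.add_apply, add_smul]; abel
      map_smul' := fun a x => by
        have : (WithLp.toLp 2 fun i : Fin n => (a • x) i.succ) =
          a • (WithLp.toLp 2 fun i : Fin n => x i.succ) := rfl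
        rw [this, map_smul, Pi.smul_apply, smul_assoc, smul_add, RingHom.id_apply] }
  have hA₀ : ∀ x y, form (A₀ x) (A₀ y) = form x y := fun x y => by
    change form (x 0 • u 0 + L _) (y 0 • u 0 + L _) = _
    have huL : ∀ z, form (u 0) (L z) = 0 := fun z => by rw [← star_form, hLu, star_zero]
    simp only [form_add_left, form_add_right, form_smul_left, form_smul_right, huu0 0 h01, hLL,
      hLu, huL, PiLp.inner_apply]
    simp [form, mul_comm]
  have hinj : Function.Injective A₀ := (injective_iff_map_eq_zero A₀).2 fun x hx =>
    eq_zero_of_form_eq_zero fun y => by rw [← hA₀, hx, form_zero_left]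
  refine ⟨LinearEquiv.ofInjectiveEndo A₀ hinj, hA₀, fun v hv hv' => ?_⟩
  have hz := norm_ballCoord_lt (point v hv)
  have hv0 : v 0 ≠ 0 := fun h => by
    rw [quad_eq, h] at hv
    have : 0 ≤ ∑ i : Fin n, ‖v i.succ‖ ^ 2 := Finset.sum_nonneg fun _ _ => by positivity
    simp only [norm_zero] at hv
    linarith
  have hb : (WithLp.toLp 2 fun i : Fin n => v i.succ) = v 0 • ballCoord (point v hv) := by
    rw [point, ballCoord_mk]
    ext i
    simp [mul_div_cancel₀ _ hv0]
  have hp : point v hv = point (lift (ballCoord (point v hv))) (quad_lift_neg hz) :=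
    ballCoord_injective (ballCoord_point_lift _).symm
  rw [hp, hfu _ hz]
  refine (point_eq_of_smul (a := v 0) ?_ _ _).symm
  change v 0 • u 0 + L _ = _
  rw [hb, map_smul, ← smul_add, ← hL _ hz, add_sub_cancel]

end ComplexHyperbolic

/-- Every holomorphic isometry of complex hyperbolic space is a commutator in the full
isometry group. -/
theorem corollary5p2 (n : ℕ) (f : ComplexHyperbolic.Isom n)
    (hf : ComplexHyperbolic.IsHolomorphic (f : Equiv.Perm (ComplexHyperbolic.Space n))) :
    ∃ α β : ComplexHyperbolic.Isom n, f = α * β * α⁻¹ * β⁻¹ := by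
  obtain ⟨A, hA, hf⟩ := ComplexHyperbolic.exists_unitary_of_isHolomorphic f hf
  exact ComplexHyperbolic.exists_commutator_of_unitary f hA hf
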